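/- **Setting.** Let $(\Omega,\mathcal F)$ be a measurable space, $\mathbb P_\star$ a measure on it, $X\subseteq\mathbb R^n$ compact, $\Theta\subseteq\mathbb R^d$, and $\{\xi_t\}_{t\ge 1}$ a stochastic process on $(\Omega,\mathcal F)$ with values in $\mathbb R^m$; let $\mathcal F_T=\sigma(\xi_1,\dots,\xi_T)$. *Ambiguity set.* $\{\mathbb P_\theta:\theta\in\Theta\}$ is called a finitely parametrized ambiguity set if $\Theta$ is convex and relatively open (open in its affine hull), each $\mathbb P_\theta$ is a probability measure on $(\Omega,\mathcal F)$, and $\mathbb P_\star\in\{\mathbb P_\theta:\theta\in\Theta\}$. *Model-based predictor.* $c:X\times\Theta\to\mathbb R$ is uniformly continuous and bounded; its unique continuous extension to $X\times\operatorname{cl}\Theta$ is also denoted by $c$. *Statistic.* $\widehat S=\{\widehat S_T\}_{T\ge1}$ is a process in $\mathbb R^d$ adapted to $\{\mathcal F_T\}_{T\ge 1}$; its state space $\mathbb S$ is the smallest closed set with $\mathbb P_\theta[\widehat S_T\in\mathbb S]=1$ for all $\theta\in\Theta$, $T\ge 1$; and there is a local homeomorphism $S_\infty:\Theta\to\mathbb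 S$ such that $\widehat S_T\to S_\infty(\theta)$ in $\mathbb P_\theta$-probability for every $\theta\in\Theta$. Let $\mathbb S_\infty=S_\infty(\Theta)$. *Rate functions.* A rate function is a map $I:\mathbb S\times\operatorname{cl}\Theta\to[0,\infty]$ that is lower semicontinuous in $s$. The statistic $\widehat S$ satisfies a large deviation principle (LDP) under $\{\mathbb P_\theta\}$ with rate function $I$ if for all $\theta\in\Theta$ and Borel sets $\mathcal D\subseteq\mathbb S$ $$-\inf_{s\in\operatorname{int}\mathcal D}I(s,\theta)\le\liminf_{T\to\infty}\tfrac1T\log\mathbb P_\theta[\widehat S_T\in\mathcal D]\le\limsup_{T\to\infty}\tfrac1T\log\mathbb P_\theta[\widehat S_T\in\mathcal D]\le-\inf_{s\in\operatorname{cl}\mathcal D}I(s,\theta),$$ with interior and closure relative to $\mathbb S$. A rate function $I$ is regular if (i) $\operatorname{cl}\{\theta\in\Theta:I(s,\theta)<r\}=\{\theta\in\operatorname{cl}\Theta:I(s,\theta)\le r\}$ for all $s\in\mathbb S_\infty$, $r>0$; (ii) $I$ is continuous on $\mathbb S\times\Theta$; (iii) $\{(s,\theta)\in\mathbb S\times\operatorname{cl}\Theta:I(s,\theta)\le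 r\}$ is compact for every $r\ge0$. *Distributionally robust predictor and prescriptor.* For $r\ge0$, the distributionally robust predictor induced by $c$, $I$ and $r$ is $\tilde c^\star(x,s)=\max\{c(x,\theta):\theta\in\operatorname{cl}\Theta,\ I(s,\theta)\le r\}$ if some $\theta\in\operatorname{cl}\Theta$ has $I(s,\theta)\le r$, and $\tilde c^\star(x,s)=\sup_{\theta\in\operatorname{cl}\Theta}c(x,\theta)$ otherwise. A corresponding distributionally robust prescriptor is any $\tilde x^\star:\mathbb S\to X$ that is quasi-continuous on $\mathbb S_\infty$ and satisfies $\tilde x^\star(s)\in\arg\min_{x\in X}\tilde c^\star(x,s)$ for all $s\in\mathbb S$. Here $f$ is quasi-continuous at $a$ if for all neighbourhoods $U$ of $a$ and $V$ of $f(a)$ there is a non-empty open $W\subseteq U$ with $f(W)\subseteq V$. **Proposition (Invariance under coordinate transformations of $\operatorname{cl}\Theta$).** Assume that $\{\mathbb P_\theta:\theta\in\Theta\}$ is a finitely parametrized ambiguity set, that $c$ is uniformly continuous and bounded on $X\times\Theta$, and that the statistic $\widehat S$ satisfies an LDP with a regular rate function $I$. Let $\varphi:\operatorname{cl}\Theta\to\operatorname{cl}\Theta$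 be a homeomorphism. Then: 1. $\varphi$ restricts to a homeomorphism of $\Theta$ onto $\Theta$, and $\mathcal P_\varphi=\{\mathbb P_{\varphi(\theta)}:\theta\in\Theta\}$ is a finitely parametrized ambiguity set that coincides, as a set of measures, with $\{\mathbb P_\theta:\theta\in\Theta\}$. 2. $c_\varphi(x,\theta)=c(x,\varphi^{-1}(\theta))$ is uniformly continuous and bounded on $X\times\Theta$, and its continuous extension to $X\times\operatorname{cl}\Theta$ is given by the same formula. 3. $I_\varphi(s,\theta)=I(s,\varphi^{-1}(\theta))$ is a regular rate function. Moreover, $\{\mathbb P_{\varphi^{-1}(\theta)}:\theta\in\Theta\}$ is a finitely parametrized ambiguity set under which $\widehat S$ is a statistic with the same state space $\mathbb S$, limit $S_\infty\circ\varphi^{-1}$ and the same set $\mathbb S_\infty$, and under which $\widehat S$ satisfies an LDP with rate function $I_\varphi$. 4. For every $r\ge0$, the maximum and the supremum defining $\tilde c^\star$ are attained and finite, respectively; the distributionally robust predictor induced by $c_\varphi$, $I_\varphi$ and $r$ equals the one induced by $c$, $I$ and $r$; and a map $\tilde x^\star:\mathbb S\to X$ is a distributionally robust prescriptor for $c_\varphi$,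 $I_\varphi$ and $r$ if and only if it is one for $c$, $I$ and $r$. -/

import Mathlib

open MeasureTheory Filter Topology Set
open scoped NNReal ENNReal

/-- The Euclidean space `ℝᵏ`. -/
abbrev E (k : ℕ) : Type := EuclideanSpace ℝ (Fin k)

namespace DataDriven

/-- The inclusion of the model space `Θ` into its closure. -/
def toClosure {d : ℕ} {Θ : Set (E d)} (θ : Θ) : closure Θ :=
  Set.inclusion subset_closure θ

/-- `{P θ : θ ∈ Θ}` is a finitely parametrized ambiguity set for `Pstar`: the model space `Θ` is a
convex subset of `ℝᵈ` that is relatively open (it equals its interior relative to its affine hull),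
every `P θ` is a probability measure, and `Pstar` is one of the measures `P θ`. -/
structure IsFinitelyParametrized {d : ℕ} {Ω : Type*} [MeasurableSpace Ω] {Θ : Set (E d)}
    (Pstar : Measure Ω) (P : Θ → Measure Ω) : Prop where
  convex : Convex ℝ Θ
  relOpen : intrinsicInterior ℝ Θ = Θ
  isProbabilityMeasure : ∀ θ, IsProbabilityMeasure (P θ)
  mem : Pstar ∈ range P

/-- The model-based predictor is uniformly continuous and bounded on `X × Θ`. -/
def IsUniformlyContinuousBounded {n d : ℕ} {X : Set (E n)} {Θ : Set (E d)}
    (c : X → Θ → ℝ) : Prop :=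
  UniformContinuous (fun p : X × Θ => c p.1 p.2) ∧ ∃ C : ℝ, ∀ x θ, |c x θ| ≤ C

theorem isDenseInducing_prod {n d : ℕ} (X : Set (E n)) (Θ : Set (E d)) :
    IsDenseInducing (Prod.map id toClosure : X × Θ → X × closure Θ) :=
  IsDenseInducing.prodMap ⟨IsInducing.id, denseRange_id⟩
    ⟨(Topology.IsEmbedding.inclusion subset_closure).isInducing,
      (denseRange_inclusion_iff subset_closure).2 subset_rfl⟩

/-- The extension of the model-based predictor from `X × Θ` to `X × cl Θ` by continuity. -/
noncomputable def predictorExt {n d : ℕ} {X : Set (E n)} {Θ : Set (E d)}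
    (c : X → Θ → ℝ) (x : X) (θ : closure Θ) : ℝ :=
  (isDenseInducing_prod X Θ).extend (fun p : X × Θ => c p.1 p.2) (x, θ)

/-- The σ-algebra generated by `ξ₁, …, ξ_T`. -/
abbrev history {m : ℕ} {Ω : Type*} (ξ : ℕ+ → Ω → E m) (T : ℕ+) : MeasurableSpace Ω :=
  ⨆ t : {t : ℕ+ // t ≤ T}, MeasurableSpace.comap (ξ t) inferInstance

/-- `S` is a statistic with state space `SS` and asymptotic realizations `Sinf θ`. The state space
is the smallest closed set that contains every `S T` almost surely under every model. -/
structure IsStatistic {m d : ℕ} {Ω : Type*} [MeasurableSpace Ω] {Θ : Set (E d)}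
    (ξ : ℕ+ → Ω → E m) (P : Θ → Measure Ω) (S : ℕ+ → Ω → E d)
    (SS : Set (E d)) (Sinf : Θ → SS) : Prop where
  adapted : ∀ T, Measurable[history ξ T] (S T)
  stateSpace : IsLeast {C : Set (E d) | IsClosed C ∧ ∀ θ T, ∀ᵐ ω ∂(P θ), S T ω ∈ C} SS
  localHomeomorph : IsLocalHomeomorph Sinf
  tendsto : ∀ θ, TendstoInMeasure (P θ) S atTop (fun _ => (Sinf θ : E d))

/-- `I : SS × cl Θ → [0, ∞]` is a rate function: it is lower semicontinuous in its first
argument. -/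
def IsRateFunction {d : ℕ} {Θ SS : Set (E d)} (I : SS → closure Θ → ℝ≥0∞) : Prop :=
  ∀ θ, LowerSemicontinuous (fun s => I s θ)

/-- The statistic `S` satisfies a large deviation principle with rate function `I`. Interiors and
closures are relative to the state space `SS`, and `log 0 = -∞`. -/
def SatisfiesLDP {d : ℕ} {Ω : Type*} [MeasurableSpace Ω] {Θ SS : Set (E d)}
    (P : Θ → Measure Ω) (S : ℕ+ → Ω → E d) (I : SS → closure Θ → ℝ≥0∞) : Prop :=
  IsRateFunction I ∧
  ∀ θ : Θ, ∀ D : Set SS, MeasurableSet D →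
    -((⨅ s ∈ interior D, I s (toClosure θ) : ℝ≥0∞) : EReal) ≤
      liminf (fun T : ℕ+ => (((1 : ℝ) / (T : ℕ) : ℝ) : EReal) *
        ENNReal.log (P θ (S T ⁻¹' (Subtype.val '' D)))) atTop ∧
    limsup (fun T : ℕ+ => (((1 : ℝ) / (T : ℕ) : ℝ) : EReal) *
        ENNReal.log (P θ (S T ⁻¹' (Subtype.val '' D)))) atTop ≤
      -((⨅ s ∈ closure D, I s (toClosure θ) : ℝ≥0∞) : EReal)

/-- The rate function `I` is regular, where `A` is the set of asymptotic realizations. -/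
structure IsRegular {d : ℕ} {Θ SS : Set (E d)} (A : Set SS)
    (I : SS → closure Θ → ℝ≥0∞) : Prop where
  rateFunction : IsRateFunction I
  radialMonotonicity : ∀ s ∈ A, ∀ r : ℝ≥0, 0 < r →
    closure {θ : closure Θ | (θ : E d) ∈ Θ ∧ I s θ < r} = {θ : closure Θ | I s θ ≤ r}
  continuity : ContinuousOn (fun p : SS × closure Θ => I p.1 p.2) {p | (p.2 : E d) ∈ Θ}
  levelCompactness : ∀ r : ℝ≥0, IsCompact {p : SS × closure Θ | I p.1 p.2 ≤ r}

open Classical in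
/-- The distributionally robust predictor induced by `I` and `r`. -/
noncomputable def droPredictor {n d : ℕ} {X : Set (E n)} {Θ SS : Set (E d)}
    (c : X → Θ → ℝ) (I : SS → closure Θ → ℝ≥0∞) (r : ℝ≥0) (x : X) (s : SS) : ℝ :=
  if ∃ θ, I s θ ≤ r then sSup (predictorExt c x '' {θ | I s θ ≤ r})
  else sSup (range (predictorExt c x))

/-- `f` is quasi-continuous at `a`. -/
def QuasiContinuousAt {α β : Type*} [TopologicalSpace α] [TopologicalSpace β]
    (f : α → β) (a : α) : Prop :=
  ∀ U ∈ 𝓝 a, ∀ V ∈ 𝓝 (f a), ∃ W : Set α, IsOpen W ∧ W.Nonempty ∧ W ⊆ U ∧ ∀ a' ∈ W, f a' ∈ V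

/-- `f` is quasi-continuous on `A`. -/
def QuasiContinuousOn {α β : Type*} [TopologicalSpace α] [TopologicalSpace β]
    (f : α → β) (A : Set α) : Prop :=
  ∀ a : A, QuasiContinuousAt (fun a' : A => f a') a

/-- `xt` is a distributionally robust prescriptor for the distributionally robust predictor
induced by `I` and `r`, where `A` is the set of asymptotic realizations. -/
def IsDROPrescriptor {n d : ℕ} {X : Set (E n)} {Θ SS : Set (E d)} (A : Set SS)
    (c : X → Θ → ℝ) (I : SS → closure Θ → ℝ≥0∞) (r : ℝ≥0) (xt : SS → X) : Prop :=
  QuasiContinuousOn xt A ∧ ∀ s x, droPredictor c I r (xt s) s ≤ droPredictor c I r x s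

end DataDriven

/-! Two facts carry the theorem; all else is a change of variables in the parameter.

The first is that `φ` preserves `Θ` (`Homeomorph.apply_mem_of_mem`). Suppose `θ ∈ Θ`. Contracting
`cl Θ` slightly towards `θ` moves it into `Θ`, by convexity and relative openness. Conjugated by
`φ`, this contraction is close to the identity on a small relative ball around `θ`, so it still
takes the value `θ` there, by a Brouwer-type argument. Hence `φ θ` lies in the image of the
contraction, inside `Θ`. The zero comes from the no-retraction theorem, proved by the volume
argument of Milnor and Rogers.

The second is that `cl Θ` is compact (`compactSpace_closure`). The large deviation upper bound and
convergence in probability give `I (Sinf θ) θ = 0`, so the compact zero level set of `I` projects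
onto a dense subset of `cl Θ`. Compactness makes the transformed predictor uniformly continuous,
although `φ` is only assumed to be a homeomorphism. -/

/-! ### No-retraction theorem and zeros of maps near the identity -/

section Brouwer

variable {V : Type*} [NormedAddCommGroup V] [InnerProductSpace ℝ V]

/-- A point of the segment from a point of the unit ball to a point outside lies on the unit
sphere. -/
theorem exists_norm_eq_one_dist_le {x y : V} (hx : ‖x‖ ≤ 1) (hy : 1 < ‖y‖) :
    ∃ z : V, ‖z‖ = 1 ∧ dist x z ≤ dist x y := by
  have hc : ContinuousOn (fun s : ℝ => ‖x + s • (y - x)‖) (Icc 0 1) := by fun_prop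
  obtain ⟨s, hs, hs1⟩ := intermediate_value_Icc zero_le_one hc
    (show (1 : ℝ) ∈ Icc _ _ by simpa using ⟨hx, hy.le⟩)
  refine ⟨x + s • (y - x), hs1, ?_⟩
  rw [dist_self_add_right, norm_smul, dist_eq_norm', Real.norm_of_nonneg hs.1]
  exact mul_le_of_le_one_left (norm_nonneg _) hs.2

/-- A map that is Lipschitz on the closed unit ball and vanishes on the unit sphere stays Lipschitz
when it is extended by zero. -/
theorem LipschitzOnWith.indicator_closedBall {K : ℝ≥0} {u : V → V}
    (hu : LipschitzOnWith K u (Metric.closedBall 0 1)) (h0 : ∀ x, ‖x‖ = 1 → u x = 0) :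
    LipschitzWith K (indicator (Metric.closedBall 0 1) u) := by
  -- Mixed case: `u` vanishes at the crossing point of the sphere, which is no farther from `x` than
  -- `y` is.
  have key : ∀ x y : V, ‖x‖ ≤ 1 → 1 < ‖y‖ → dist (u x) 0 ≤ K * dist x y := by
    intro x y hx hy
    obtain ⟨z, hz, hzd⟩ := exists_norm_eq_one_dist_le hx hy
    rw [← h0 z hz]
    exact (hu.dist_le_mul x (by simpa using hx) z (by simp [hz])).trans (by gcongr)
  refine LipschitzWith.of_dist_le_mul fun x y => ?_
  by_cases hx : x ∈ Metric.closedBall (0 : V) 1 <;> by_cases hy : y ∈ Metric.closedBall (0 : V) 1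
  · simpa only [indicator_of_mem hx, indicator_of_mem hy] using hu.dist_le_mul x hx y hy
  · rw [indicator_of_mem hx, indicator_of_notMem hy]
    exact key x y (by simpa using hx) (by simpa using hy)
  · rw [indicator_of_notMem hx, indicator_of_mem hy, dist_comm, dist_comm x]
    exact key y x (by simpa using hy) (by simpa using hx)
  · rw [indicator_of_notMem hx, indicator_of_notMem hy, dist_self]
    positivity

variable [FiniteDimensional ℝ V]

/-- For small `t`, the map `id + t u` is a bijection of the closed unit ball. -/
theorem bijOn_closedBall_add_smul {K : ℝ≥0} {u : V → V}
    (hu : LipschitzOnWith K u (Metric.closedBall 0 1)) (h0 : ∀ x, ‖x‖ = 1 → u x = 0)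
    (hmaps : ∀ x, ‖x‖ ≤ 1 → ‖x + u x‖ ≤ 1) {t : ℝ} (ht : 0 ≤ t) (ht1 : t ≤ 1) (htK : t * K < 1) :
    BijOn (fun x => x + t • u x) (Metric.closedBall 0 1) (Metric.closedBall 0 1) := by
  refine ⟨fun x hx => ?_, fun x hx y hy hxy => ?_, fun y hy => ?_⟩
  · rw [mem_closedBall_zero_iff] at hx ⊢
    have : x + t • u x = (1 - t) • x + t • (x + u x) := by module
    simp only [this]
    refine (norm_add_le _ _).trans ?_
    rw [norm_smul, norm_smul, Real.norm_of_nonneg ht, Real.norm_of_nonneg (sub_nonneg.2 ht1)]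
    have := hmaps x hx
    nlinarith
  · have h1 : x - y = t • (u y - u x) := by
      have : x + t • u x = y + t • u y := hxy
      rw [smul_sub, sub_eq_sub_iff_add_eq_add, this, add_comm]
    have h2 : dist x y ≤ t * (K * dist x y) := by
      have := hu.dist_le_mul x hx y hy
      calc dist x y = t * dist (u x) (u y) := by
            rw [dist_eq_norm x y, h1, norm_smul, Real.norm_of_nonneg ht, ← dist_eq_norm, dist_comm]
        _ ≤ _ := by gcongr
    have h3 : dist x y ≤ 0 := by
      by_contra! h
      nlinarith
    exact dist_le_zero.1 h3
  -- Surjectivity: a preimage of `y` is a fixed point of the contraction `x ↦ y - t v x`. Outside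
  -- the ball `v` vanishes, which would force the fixed point to equal `y`, a point of the ball.
  · have hL := hu.indicator_closedBall h0
    set v := indicator (Metric.closedBall 0 1) u
    lift t to ℝ≥0 using ht
    have hcon : ContractingWith (t * K) fun x => y - (t : ℝ) • v x := by
      refine ⟨by exact_mod_cast htK, LipschitzWith.of_dist_le_mul fun a b => ?_⟩
      rw [dist_sub_left, dist_smul₀, NNReal.norm_eq, NNReal.coe_mul, mul_assoc]
      exact mul_le_mul_of_nonneg_left (hL.dist_le_mul a b) t.2
    have hfix : y - (t : ℝ) • v (ContractingWith.fixedPoint _ hcon) = ContractingWith.fixedPoint _ hcon :=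
      hcon.fixedPoint_isFixedPt
    set x := ContractingWith.fixedPoint _ hcon
    have hx : x ∈ Metric.closedBall (0 : V) 1 := by
      by_contra hx
      rw [show v x = 0 from indicator_of_notMem hx _, smul_zero, sub_zero] at hfix
      exact hx (hfix ▸ hy)
    refine ⟨x, hx, ?_⟩
    rw [show v x = u x from indicator_of_mem hx _] at hfix
    simp only
    nth_rw 1 [← hfix]
    abel

/-- The values of the polynomial `t ↦ det (1 + t A)` at `1` from those at finitely many nodes. -/
theorem ContinuousLinearMap.det_one_add_eq_sum {v : Fin (Module.finrank ℝ V + 1) → ℝ}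
    (hv : Function.Injective v) (A : V →L[ℝ] V) :
    (1 + A).det = ∑ j, (Lagrange.basis Finset.univ v j).eval 1 * (1 + v j • A).det := by
  classical
  let b := Module.finBasis ℝ V
  let M := LinearMap.toMatrix b b A
  let p : Polynomial ℝ := ((Polynomial.X : Polynomial ℝ) • M.map Polynomial.C
    + (1 : Matrix _ _ ℝ).map Polynomial.C).det
  have hp : ∀ t : ℝ, p.eval t = (1 + t • A).det := by
    intro t
    rw [ContinuousLinearMap.det, ← LinearMap.det_toMatrix b]
    simp only [p]
    rw [← Polynomial.coe_evalRingHom, RingHom.map_det]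
    have : LinearMap.toMatrix b b (1 + t • A : V →L[ℝ] V) = 1 + t • M := by
      rw [ContinuousLinearMap.toLinearMap_add, ContinuousLinearMap.toLinearMap_smul,
        ContinuousLinearMap.toLinearMap_one, map_add, map_smul, LinearMap.toMatrix_one]
    rw [this]
    congr 1
    ext i j
    simp [M, Matrix.one_apply, apply_ite, add_comm]
    ring
  -- The degree is at most the dimension, so one node more than the dimension determines `p`.
  have hdeg : p.degree < (Finset.univ : Finset (Fin (Module.finrank ℝ V + 1))).card := by
    refine (Polynomial.degree_le_natDegree).trans_lt ?_
    have := Polynomial.natDegree_det_X_add_C_le M 1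
    simp only [Fintype.card_fin] at this
    simp only [Finset.card_univ, Fintype.card_fin]
    exact_mod_cast Nat.lt_succ_of_le this
  have h := congrArg (Polynomial.eval 1) (Lagrange.eq_interpolate hv.injOn hdeg)
  rw [hp, one_smul, Lagrange.interpolate_apply, Polynomial.eval_finsetSum] at h
  rw [h]
  refine Finset.sum_congr rfl fun j _ => ?_
  rw [Polynomial.eval_mul, Polynomial.eval_C, hp, mul_comm]

/-- There is no continuously differentiable retraction of the closed unit ball onto the unit
sphere. -/
theorem not_exists_contDiff_retraction (r : V → V) (hr : ContDiff ℝ 1 r)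
    (hnorm : ∀ x, ‖r x‖ = 1) (hid : ∀ x, ‖x‖ = 1 → r x = x) : False := by
  borelize V
  let B : Set V := Metric.closedBall 0 1
  have hB : IsCompact B := isCompact_closedBall 0 1
  -- `id + t u` is the straight-line homotopy from the identity to `r`.
  let u : V → V := fun x => r x - x
  have hu : ContDiff ℝ 1 u := hr.sub contDiff_id
  have hu' : Continuous (fderiv ℝ u) := hu.continuous_fderiv one_ne_zero
  obtain ⟨K, hK⟩ := hu.contDiffOn.exists_lipschitzOnWith one_ne_zero (convex_closedBall 0 1) hB
  have h0 : ∀ x, ‖x‖ = 1 → u x = 0 := fun x hx => by simp [u, hid x hx]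
  have hmaps : ∀ x, ‖x‖ ≤ 1 → ‖x + u x‖ ≤ 1 := fun x _ => by simp [u, hnorm x]
  have hder : ∀ (t : ℝ) (x : V), HasFDerivAt (fun x => x + t • u x) (1 + t • fderiv ℝ u x) x :=
    fun t x => (hasFDerivAt_id x).add
      (((hu.differentiable one_ne_zero) x).hasFDerivAt.const_smul t)
  have hcont : ∀ t : ℝ, Continuous fun x => (1 + t • fderiv ℝ u x).det := fun t =>
    ContinuousLinearMap.continuous_det.comp (by fun_prop)
  -- the determinants are positive for small `t`
  have hev : ∀ᶠ t : ℝ in 𝓝 0, ∀ x ∈ B, 0 < (1 + t • fderiv ℝ u x).det := by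
    refine hB.eventually_forall_of_forall_eventually fun x _ => ?_
    have hc : Continuous fun z : ℝ × V => (1 + z.1 • fderiv ℝ u z.2).det :=
      ContinuousLinearMap.continuous_det.comp (by fun_prop)
    refine hc.continuousAt.eventually (lt_mem_nhds ?_)
    simp [ContinuousLinearMap.det]
  have hev2 : ∀ᶠ t : ℝ in 𝓝 0, t * K < 1 := by
    have : Continuous fun t : ℝ => t * K := by fun_prop
    exact this.continuousAt.eventually (gt_mem_nhds (by simp))
  obtain ⟨δ, hδ, hball⟩ := Metric.eventually_nhds_iff.1 (hev.and hev2)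
  -- Change of variables: for small `t` the map `id + t u` carries the ball bijectively onto itself.
  have hvol : ∀ t : ℝ, 0 ≤ t → t ≤ 1 → t < δ →
      ∫ x in B, (1 + t • fderiv ℝ u x).det = volume.real B := by
    intro t ht ht1 htδ
    obtain ⟨hpos, htK⟩ := hball (y := t) (by simpa [abs_of_nonneg ht] using htδ)
    have hbij := bijOn_closedBall_add_smul hK h0 hmaps ht ht1 htK
    have := integral_image_eq_integral_abs_det_fderiv_smul volume hB.measurableSet
      (fun x _ => (hder t x).hasFDerivWithinAt) hbij.injOn (fun _ => (1 : ℝ))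
    rw [hbij.image_eq] at this
    simp only [integral_const, smul_eq_mul, mul_one, measureReal_restrict_apply_univ] at this
    rw [this]
    exact setIntegral_congr_fun hB.measurableSet fun x hx => (abs_of_pos (hpos x hx)).symm
  -- interpolation from small nodes
  let N := Module.finrank ℝ V
  let ε := min 1 δ / 2
  have hε : 0 < ε := by positivity
  let v : Fin (N + 1) → ℝ := fun j => ε / ((j : ℕ) + 1)
  have hv : Function.Injective v := by
    intro i j hij
    have h1 : ((i : ℕ) + 1 : ℝ) ≠ 0 := by positivity
    have h2 : ((j : ℕ) + 1 : ℝ) ≠ 0 := by positivity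
    simp only [v] at hij
    rw [div_eq_div_iff h1 h2] at hij
    have := mul_left_cancel₀ hε.ne' hij
    exact Fin.ext (by exact_mod_cast (add_right_cancel this).symm)
  have hvle : ∀ j, v j ≤ ε := fun j => div_le_self hε.le (by simp)
  have hε1 : ε < 1 := by
    have : min 1 δ ≤ 1 := min_le_left _ _
    simp only [ε]; linarith
  have hεδ : ε < δ := by
    have : min 1 δ ≤ δ := min_le_right _ _
    simp only [ε]; linarith
  -- The integral is a polynomial in `t` with the same value at all nodes. Since the Lagrange basis
  -- sums to one, it has that value at `t = 1` too.
  have hint : ∫ x in B, (1 + fderiv ℝ u x).det = volume.real B := by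
    rw [setIntegral_congr_fun hB.measurableSet fun x _ =>
      ContinuousLinearMap.det_one_add_eq_sum hv (fderiv ℝ u x)]
    rw [integral_finsetSum _ fun j _ =>
      (((hcont (v j)).continuousOn.integrableOn_compact hB).const_mul _)]
    simp_rw [integral_const_mul]
    rw [Finset.sum_congr rfl fun j _ => by
      rw [hvol (v j) (by positivity) ((hvle j).trans hε1.le) ((hvle j).trans_lt hεδ)],
      ← Finset.sum_mul, ← Polynomial.eval_finsetSum, Lagrange.sum_basis hv.injOn (by simp)]
    simp
  -- at time one the derivative is singular
  have hdet : ∀ x, (1 + fderiv ℝ u x).det = 0 := by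
    intro x
    by_contra hne
    have hr' : HasFDerivAt r (1 + fderiv ℝ u x) x := by
      have := hder 1 x
      simpa [u] using this
    -- Differentiating `‖r‖² = 1` makes the range of the derivative orthogonal to `r x`; an
    -- invertible derivative would reach `r x` itself.
    have horth : ∀ w, inner ℝ (r x) ((1 + fderiv ℝ u x) w) = 0 := by
      intro w
      have h1 := hr'.norm_sq
      have h2 : HasFDerivAt (fun y => ‖r y‖ ^ 2) (0 : V →L[ℝ] ℝ) x := by
        simp_rw [hnorm]; exact hasFDerivAt_const _ _
      have := DFunLike.congr_fun (h1.unique h2) w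
      simpa [← mul_add, ← inner_add_right] using this
    have hsurj : Function.Surjective (1 + fderiv ℝ u x : V →L[ℝ] V) :=
      ((LinearMap.isUnit_iff_range_eq_top _).1
        (LinearMap.isUnit_iff_isUnit_det _ |>.2 (isUnit_iff_ne_zero.2 hne)) |> LinearMap.range_eq_top.1)
    obtain ⟨w, hw⟩ := hsurj (r x)
    have := horth w
    rw [hw, real_inner_self_eq_norm_sq, hnorm] at this
    norm_num at this
  have hvolpos : 0 < volume.real B :=
    ENNReal.toReal_pos (Metric.measure_closedBall_pos volume 0 one_pos).ne' hB.measure_lt_top.ne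
  simp_rw [hdet] at hint
  simp at hint
  exact hvolpos.ne hint

/-- A continuous map that is close to the identity on the closed unit ball has a zero there. -/
theorem exists_eq_zero_of_norm_sub_le {g : V → V} (hg : Continuous g)
    (hclose : ∀ x, ‖x‖ ≤ 1 → ‖g x - x‖ < 1 / 8) : ∃ x, ‖x‖ ≤ 1 ∧ g x = 0 := by
  by_contra! hne
  obtain ⟨x₀, hx₀, hmin⟩ := (isCompact_closedBall (0 : V) 1).exists_isMinOn
    ⟨0, by simp⟩ hg.norm.continuousOn
  have hm : 0 < ‖g x₀‖ := norm_pos_iff.2 (hne x₀ (by simpa using hx₀))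
  -- The tolerance `‖g x₀‖` keeps `p` nonzero on the ball; the tolerance `1 / 8` keeps it within `1
  -- / 4` of the identity.
  obtain ⟨p, hp, hpg, -⟩ := hg.exists_contDiff_approx (ε := fun _ => min ‖g x₀‖ (1 / 8)) 1
    continuous_const fun _ => lt_min hm (by norm_num)
  have hp0 : ∀ x, ‖x‖ ≤ 1 → p x ≠ 0 := by
    intro x hx h0
    have h1 : ‖g x₀‖ ≤ ‖g x‖ := hmin (by simpa using hx)
    have h2 := (hpg x).trans_le (min_le_left _ _)
    rw [h0, dist_zero_left] at h2
    exact absurd h1 (not_le.2 h2)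
  have hpx : ∀ x, ‖x‖ ≤ 1 → ‖p x - x‖ < 1 / 4 := by
    intro x hx
    have h1 := (hpg x).trans_le (min_le_right _ _)
    rw [dist_eq_norm] at h1
    have := norm_add_le (p x - g x) (g x - x)
    rw [sub_add_sub_cancel] at this
    linarith [hclose x hx]
  -- `q` equals `p` up to radius `1 / 2` and the identity from `3 / 4` on. In between, `‖x‖ > 1 / 2`
  -- exceeds the perturbation, so `q` has no zero and `q / ‖q‖` is a retraction.
  let χ : ContDiffBump (0 : V) := ⟨1 / 2, 3 / 4, by norm_num, by norm_num⟩
  let q : V → V := fun x => x + χ x • (p x - x)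
  have hq : ContDiff ℝ 1 q := contDiff_id.add (χ.contDiff.smul (hp.sub contDiff_id))
  have hqid : ∀ x, 3 / 4 ≤ ‖x‖ → q x = x := by
    intro x hx
    simp [q, χ.zero_of_le_dist (x := x) (by simpa using hx)]
  have hq0 : ∀ x, q x ≠ 0 := by
    intro x h0
    rcases le_or_gt (3 / 4) ‖x‖ with hx | hx
    · rw [hqid x hx] at h0
      rw [h0, norm_zero] at hx
      norm_num at hx
    rcases le_or_gt ‖x‖ (1 / 2) with hx2 | hx2
    · have : χ x = 1 := χ.one_of_mem_closedBall (by simpa [χ] using hx2)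
      simp only [q, this, one_smul, add_sub_cancel] at h0
      exact hp0 x (by linarith) h0
    · have h1 : ‖x‖ = ‖χ x • (p x - x)‖ := by
        rw [eq_neg_of_add_eq_zero_left h0, norm_neg]
        simp [← eq_neg_of_add_eq_zero_left h0]
      rw [norm_smul, Real.norm_of_nonneg χ.nonneg] at h1
      have := hpx x (by linarith)
      nlinarith [χ.le_one (x := x), χ.nonneg (x := x), norm_nonneg (p x - x)]
  refine not_exists_contDiff_retraction (fun x => ‖q x‖⁻¹ • q x) ?_ ?_ ?_
  · exact ((hq.norm ℝ hq0).inv fun x => norm_ne_zero_iff.2 (hq0 x)).smul hq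
  · intro x
    rw [norm_smul, norm_inv, norm_norm, inv_mul_cancel₀ (norm_ne_zero_iff.2 (hq0 x))]
  · intro x hx
    rw [hqid x (by rw [hx]; norm_num), hx, inv_one, one_smul]

end Brouwer

/-! ### Homeomorphisms of the closure of a relatively open convex set -/

section Convex

variable {V : Type*} [NormedAddCommGroup V] [InnerProductSpace ℝ V] {Θ : Set V}

theorem exists_ball_of_intrinsicInterior_eq (hΘ : intrinsicInterior ℝ Θ = Θ) {p : V} (hp : p ∈ Θ) :
    ∃ ε > 0, ∀ z ∈ affineSpan ℝ Θ, dist z p < ε → z ∈ Θ := by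
  rw [← hΘ, mem_intrinsicInterior] at hp
  obtain ⟨y, hy, rfl⟩ := hp
  obtain ⟨ε, hε, h⟩ := Metric.mem_nhds_iff.1 (mem_interior_iff_mem_nhds.1 hy)
  exact ⟨ε, hε, fun z hz hzp => h (show (⟨z, hz⟩ : affineSpan ℝ Θ) ∈ Metric.ball y ε from hzp)⟩

variable [FiniteDimensional ℝ V]

theorem closure_subset_affineSpan : closure Θ ⊆ affineSpan ℝ Θ :=
  closure_minimal (subset_affineSpan ℝ Θ) (affineSpan ℝ Θ).closed_of_finiteDimensional

/-- A relatively open convex set absorbs the half-open segments from its points to the points of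
its closure. -/
theorem Convex.lineMap_mem_of_mem_closure (hconv : Convex ℝ Θ) (hΘ : intrinsicInterior ℝ Θ = Θ)
    {p y : V} (hp : p ∈ Θ) (hy : y ∈ closure Θ) {t : ℝ} (ht : 0 < t) (ht1 : t ≤ 1) :
    AffineMap.lineMap y p t ∈ Θ := by
  obtain ⟨ε, hε, hball⟩ := exists_ball_of_intrinsicInterior_eq hΘ hp
  obtain ⟨y', hy', hd⟩ := Metric.mem_closure_iff.1 hy (ε * t) (by positivity)
  -- Chosen so that the point on the segment is also `(1 - t) y' + t z`, with `y'` in `Θ`; the bound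
  -- `ε * t` on the distance from `y` to `y'` puts `z` within `ε` of `p`.
  let z := p + ((1 - t) / t) • (y - y')
  have hz : z ∈ Θ := by
    refine hball z ?_ ?_
    · have := AffineSubspace.vadd_mem_of_mem_direction
        ((affineSpan ℝ Θ).direction.smul_mem ((1 - t) / t) (AffineSubspace.vsub_mem_direction
          (closure_subset_affineSpan hy) (subset_affineSpan ℝ Θ hy')))
          (subset_affineSpan ℝ Θ hp)
      simpa [z, add_comm] using this
    · simp only [z]
      rw [dist_self_add_left, norm_smul, Real.norm_of_nonneg (by have := sub_nonneg.2 ht1; positivity),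
        div_mul_eq_mul_div, div_lt_iff₀ ht]
      rw [dist_eq_norm] at hd
      nlinarith [norm_nonneg (y - y')]
  have heq : AffineMap.lineMap y p t = (1 - t) • y' + t • z := by
    simp only [z, AffineMap.lineMap_apply_module, smul_add, smul_smul]
    rw [mul_div_cancel₀ _ ht.ne']
    module
  rw [heq]
  exact hconv hy' hz (sub_nonneg.2 ht1) ht.le (by ring)

/-- A homeomorphism of the closure of a relatively open convex set preserves the set. -/
theorem Homeomorph.apply_mem_of_mem (hconv : Convex ℝ Θ) (hΘ : intrinsicInterior ℝ Θ = Θ)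
    (φ : closure Θ ≃ₜ closure Θ) {θ : closure Θ} (hθ : (θ : V) ∈ Θ) : (φ θ : V) ∈ Θ := by
  by_contra hφ
  obtain ⟨ε, hε, hball⟩ := exists_ball_of_intrinsicInterior_eq hΘ hθ
  let W := (affineSpan ℝ Θ).direction
  let δ := ε / 2
  have hδ : 0 < δ := half_pos hε
  -- a parametrization of a relative ball around `θ` by the unit ball of `W`
  let ρ : W → W := fun w => (max 1 ‖w‖)⁻¹ • w
  -- The radial retraction `ρ` lets the parametrization be defined and continuous on all of `W`, as
  -- the zero lemma needs.
  have hρ : Continuous ρ :=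
    ((continuous_const.max continuous_norm).inv₀ fun w => by positivity).smul continuous_id
  have hρ1 : ∀ w, ‖ρ w‖ ≤ 1 := by
    intro w
    rw [norm_smul, norm_inv, Real.norm_of_nonneg (by positivity), inv_mul_le_iff₀ (by positivity)]
    simp
  have hρid : ∀ w, ‖w‖ ≤ 1 → ρ w = w := by
    intro w hw
    simp only [ρ]
    rw [max_eq_left hw, inv_one, one_smul]
  have hmem : ∀ w : W, (θ : V) + δ • (ρ w : V) ∈ Θ := by
    intro w
    refine hball _ ?_ ?_
    · have := AffineSubspace.vadd_mem_of_mem_direction (W.smul_mem δ (ρ w).2)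
        (subset_affineSpan ℝ Θ hθ)
      simpa [add_comm] using this
    · rw [dist_self_add_left, norm_smul, Real.norm_of_nonneg hδ.le]
      have := hρ1 w
      rw [← Submodule.coe_norm] at *
      have : δ < ε := half_lt_self hε
      nlinarith [norm_nonneg (ρ w)]
  let e : W → closure Θ := fun w => ⟨_, subset_closure (hmem w)⟩
  have he : Continuous e := by
    refine Continuous.subtype_mk ?_ _
    fun_prop
  -- pushing into `Θ`
  let τ : ℝ → ℝ := fun t => max 0 (min t 1)
  have hτ : Continuous τ := by fun_prop
  have hpush : ∀ (t : ℝ) (y : closure Θ), AffineMap.lineMap (y : V) (θ : V) (τ t) ∈ closure Θ := by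
    intro t y
    rw [AffineMap.lineMap_apply_module]
    exact hconv.closure y.2 θ.2 (by simp [τ]) (by simp [τ]) (by ring)
  let push : ℝ × closure Θ → closure Θ := fun z => ⟨_, hpush z.1 z.2⟩
  have hpc : Continuous push := by
    refine Continuous.subtype_mk ?_ _
    simp only [AffineMap.lineMap_apply_module]
    fun_prop
  -- The contraction towards `θ`, applied after `φ` and pulled back by `φ.symm`; at `t = 0` it does
  -- nothing.
  let G : ℝ × W → closure Θ := fun z => φ.symm (push (z.1, φ (e z.2)))
  have hG : Continuous G := by fun_prop
  have hG0 : ∀ w, G (0, w) = e w := by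
    intro w
    have : push (0, φ (e w)) = φ (e w) := by
      apply Subtype.ext
      simp [push, τ]
    simp [G, this]
  let D : ℝ × W → W := fun z => ⟨(G z : V) - θ, AffineSubspace.vsub_mem_direction
    (closure_subset_affineSpan (G z).2) (subset_affineSpan ℝ Θ hθ)⟩
  have hD : Continuous D := Continuous.subtype_mk (by fun_prop) _
  let g : ℝ × W → W := fun z => δ⁻¹ • D z
  have hgc : Continuous g := (continuous_const_smul δ⁻¹).comp hD
  have hg0 : ∀ w, ‖w‖ ≤ 1 → g (0, w) = w := by
    intro w hw
    apply Subtype.ext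
    simp [g, D, hG0, e, hρid w hw, smul_smul, inv_mul_cancel₀ hδ.ne']
  -- Compactness of the ball makes the closeness to the identity uniform in `w`; clamping by `τ`
  -- allows a two-sided neighbourhood of `0`.
  have hev : ∀ᶠ t : ℝ in 𝓝 0, ∀ w ∈ Metric.closedBall (0 : W) 1, ‖g (t, w) - w‖ < 1 / 8 := by
    refine (isCompact_closedBall _ _).eventually_forall_of_forall_eventually fun w hw => ?_
    have hc : Continuous fun z : ℝ × W => ‖g (z.1, z.2) - z.2‖ := by fun_prop
    refine hc.continuousAt.eventually (gt_mem_nhds ?_)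
    simp [hg0 w (by simpa using hw)]
  obtain ⟨t, ⟨ht, ht1⟩, ht0 : 0 < t⟩ := (((hev.and (gt_mem_nhds (zero_lt_one' ℝ))).filter_mono
    (nhdsWithin_le_nhds (s := Ioi 0))).and self_mem_nhdsWithin).exists
  obtain ⟨w, hw, hgw⟩ := exists_eq_zero_of_norm_sub_le (g := fun w => g (t, w)) (by fun_prop)
    fun w hw => ht w (by simpa using hw)
  have hGw : G (t, w) = θ := by
    have := (smul_eq_zero_iff_right (inv_ne_zero hδ.ne')).1 hgw
    exact Subtype.ext (sub_eq_zero.1 (congrArg Subtype.val this))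
  -- Now `φ θ` is the push of `φ (e w)` by a positive `t`, hence in `Θ`.
  apply hφ
  rw [← hGw, φ.apply_symm_apply]
  have : τ t = t := by simp [τ, ht1.le, ht0.le]
  exact hconv.lineMap_mem_of_mem_closure hΘ hθ (φ (e w)).2 (by rwa [this]) (by rw [this]; exact ht1.le)

end Convex

/-! ### Compactness of the parameter space and transport along homeomorphisms -/

namespace DataDriven

variable {n m d : ℕ} {Ω : Type*} [MeasurableSpace Ω] {X : Set (E n)} {Θ SS : Set (E d)}

/-- The restriction to `Θ` of a homeomorphism of `cl Θ` that preserves `Θ` in both directions. -/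
def restrictHomeomorph (φ : closure Θ ≃ₜ closure Θ)
    (h : ∀ θ : closure Θ, (θ : E d) ∈ Θ → (φ θ : E d) ∈ Θ)
    (h' : ∀ θ : closure Θ, (θ : E d) ∈ Θ → (φ.symm θ : E d) ∈ Θ) : Θ ≃ₜ Θ where
  toFun θ := ⟨φ (toClosure θ), h _ θ.2⟩
  invFun θ := ⟨φ.symm (toClosure θ), h' _ θ.2⟩
  left_inv θ := by
    apply Subtype.ext
    change (φ.symm (φ (toClosure θ)) : E d) = θ
    rw [φ.symm_apply_apply]; rfl
  right_inv θ := by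
    apply Subtype.ext
    change (φ (φ.symm (toClosure θ)) : E d) = θ
    rw [φ.apply_symm_apply]; rfl
  continuous_toFun := Continuous.subtype_mk (continuous_subtype_val.comp
    (φ.continuous.comp (continuous_inclusion subset_closure))) _
  continuous_invFun := Continuous.subtype_mk (continuous_subtype_val.comp
    (φ.symm.continuous.comp (continuous_inclusion subset_closure))) _

theorem IsFinitelyParametrized.comp_homeomorph {Pstar : Measure Ω} {P : Θ → Measure Ω}
    (hP : IsFinitelyParametrized Pstar P) (e : Θ ≃ₜ Θ) :
    IsFinitelyParametrized Pstar fun θ => P (e θ) where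
  convex := hP.convex
  relOpen := hP.relOpen
  isProbabilityMeasure θ := hP.isProbabilityMeasure _
  mem := by
    exact (e.surjective.range_comp P).symm ▸ hP.mem

theorem IsStatistic.comp_homeomorph {ξ : ℕ+ → Ω → E m} {P : Θ → Measure Ω} {S : ℕ+ → Ω → E d}
    {Sinf : Θ → SS} (hS : IsStatistic ξ P S SS Sinf) (e : Θ ≃ₜ Θ) :
    IsStatistic ξ (fun θ => P (e θ)) S SS (fun θ => Sinf (e θ)) where
  adapted := hS.adapted
  stateSpace := by
    have : {C : Set (E d) | IsClosed C ∧ ∀ θ T, ∀ᵐ ω ∂(P (e θ)), S T ω ∈ C} =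
        {C : Set (E d) | IsClosed C ∧ ∀ θ T, ∀ᵐ ω ∂(P θ), S T ω ∈ C} := by
      ext C
      exact and_congr_right fun _ =>
        (e.surjective.forall (p := fun θ => ∀ T, ∀ᵐ ω ∂(P θ), S T ω ∈ C)).symm
    rw [this]
    exact hS.stateSpace
  localHomeomorph := hS.localHomeomorph.comp e.isLocalHomeomorph
  tendsto θ := hS.tendsto _

/-- The rate function vanishes at the asymptotic realization of the statistic. -/
theorem rate_eq_zero {ξ : ℕ+ → Ω → E m} {P : Θ → Measure Ω} {S : ℕ+ → Ω → E d}
    {Sinf : Θ → SS} (hprob : ∀ θ, IsProbabilityMeasure (P θ)) (hS : IsStatistic ξ P S SS Sinf)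
    {I : SS → closure Θ → ℝ≥0∞} (hLDP : SatisfiesLDP P S I) (θ : Θ) :
    I (Sinf θ) (toClosure θ) = 0 := by
  by_contra hne
  have := hprob θ
  -- By lower semicontinuity the rate exceeds some `a > 0` on a closed ball around the limit. The
  -- upper bound would then make the ball's probability decay exponentially, against convergence in
  -- probability.
  obtain ⟨a, ha0, ha⟩ := exists_between (pos_iff_ne_zero.2 hne)
  obtain ⟨ε, hε, hball⟩ := Metric.nhds_basis_closedBall.mem_iff.1
    (hLDP.1 (toClosure θ) (Sinf θ) a ha)
  let D : Set SS := Metric.closedBall (Sinf θ) ε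
  have hD : IsClosed D := Metric.isClosed_closedBall
  have hinf : a ≤ ⨅ s ∈ closure D, I s (toClosure θ) := by
    rw [hD.closure_eq]
    exact le_iInf₂ fun s hs => (hball hs).le
  have hub := (hLDP.2 θ D hD.measurableSet).2
  -- the statistic lies in `D` with probability at least one half, eventually
  have hsmall : ∀ᶠ T in atTop, P θ {ω | ENNReal.ofReal ε ≤ edist (S T ω) (Sinf θ : E d)} < 1 / 2 :=
    (hS.tendsto θ (ENNReal.ofReal ε) (by simpa using hε)).eventually (gt_mem_nhds (by simp))
  have hhalf : ∀ᶠ T in atTop, 1 / 2 ≤ P θ (S T ⁻¹' (Subtype.val '' D)) := by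
    filter_upwards [hsmall] with T hT
    have hnull : P θ {ω | S T ω ∉ SS} = 0 := hS.stateSpace.1.2 θ T
    have hcover : (univ : Set Ω) ⊆ S T ⁻¹' (Subtype.val '' D) ∪
        ({ω | ENNReal.ofReal ε ≤ edist (S T ω) (Sinf θ : E d)} ∪ {ω | S T ω ∉ SS}) := by
      intro ω _
      by_cases h1 : S T ω ∈ SS
      · by_cases h2 : ENNReal.ofReal ε ≤ edist (S T ω) (Sinf θ : E d)
        · exact Or.inr (Or.inl h2)
        · refine Or.inl ⟨⟨S T ω, h1⟩, ?_, rfl⟩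
          rw [not_le, edist_lt_ofReal] at h2
          exact h2.le
      · exact Or.inr (Or.inr h1)
    have h1 := (measure_mono (μ := P θ) hcover).trans ((measure_union_le _ _).trans
      (add_le_add_right (measure_union_le _ _) _))
    rw [hnull, add_zero, measure_univ] at h1
    by_contra! h2
    have h3 := ENNReal.add_lt_add h2 hT
    rw [ENNReal.add_halves] at h3
    exact absurd h1 (not_le.2 h3)
  -- A probability of at least `1 / 2` has a finite logarithmic lower bound, which division by `T`
  -- sends to `0`.
  let b : ℝ := (ENNReal.log (1 / 2)).toReal
  have hb : (b : EReal) = ENNReal.log (1 / 2) := by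
    refine EReal.coe_toReal ?_ ?_
    · simp [ENNReal.log_eq_top_iff]
    · simp [ENNReal.log_eq_bot_iff]
  have hlim : Tendsto (fun T : ℕ+ => (((1 : ℝ) / (T : ℕ) : ℝ) : EReal) * (b : EReal)) atTop
      (𝓝 0) := by
    have h1 : Tendsto (fun T : ℕ+ => (1 : ℝ) / (T : ℕ) * b) atTop (𝓝 0) := by
      have := (tendsto_one_div_atTop_nhds_zero_nat (𝕜 := ℝ)).comp tendsto_PNat_val_atTop_atTop
      simpa using this.mul_const b
    have h2 := (continuous_coe_real_ereal.tendsto 0).comp h1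
    simpa [Function.comp_def] using h2
  have hlow : (0 : EReal) ≤ limsup (fun T : ℕ+ => (((1 : ℝ) / (T : ℕ) : ℝ) : EReal) *
      ENNReal.log (P θ (S T ⁻¹' (Subtype.val '' D)))) atTop := by
    rw [← hlim.limsup_eq]
    refine limsup_le_limsup (hhalf.mono fun T hT => ?_)
    simp only
    rw [hb]
    exact mul_le_mul_of_nonneg_left (ENNReal.log_monotone hT)
      (by exact_mod_cast (by positivity : (0 : ℝ) ≤ 1 / (T : ℕ)))
  have h0 := hlow.trans hub
  rw [EReal.le_neg, neg_zero] at h0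
  have h1 : (⨅ s ∈ closure D, I s (toClosure θ)) ≤ 0 := by exact_mod_cast h0
  exact absurd (hinf.trans h1) (not_le.2 ha0)

/-- A regular rate function of a large deviation principle forces the model space to be
relatively compact. -/
theorem compactSpace_closure {ξ : ℕ+ → Ω → E m} {P : Θ → Measure Ω} {S : ℕ+ → Ω → E d}
    {Sinf : Θ → SS} (hprob : ∀ θ, IsProbabilityMeasure (P θ)) (hS : IsStatistic ξ P S SS Sinf)
    {I : SS → closure Θ → ℝ≥0∞} (hLDP : SatisfiesLDP P S I) {A : Set SS} (hI : IsRegular A I) :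
    CompactSpace (closure Θ) := by
  have hK := (hI.levelCompactness 0).image continuous_snd
  have hdense : DenseRange (toClosure : Θ → closure Θ) :=
    (denseRange_inclusion_iff subset_closure).2 subset_rfl
  have hsub : range (toClosure : Θ → closure Θ) ⊆
      Prod.snd '' {p : SS × closure Θ | I p.1 p.2 ≤ (0 : ℝ≥0)} := by
    rintro _ ⟨θ, rfl⟩
    exact ⟨(Sinf θ, toClosure θ), (rate_eq_zero hprob hS hLDP θ).le, rfl⟩
  refine ⟨?_⟩
  rwa [← univ_subset_iff.1 (hdense.closure_eq ▸ hK.isClosed.closure_subset_iff.2 hsub)]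

/-- Only radial monotonicity and continuity refer to `Θ` and need `he`; the other two conditions
transport along any homeomorphism of `cl Θ`. -/
theorem IsRegular.comp_homeomorph {A : Set SS} {I : SS → closure Θ → ℝ≥0∞} (hI : IsRegular A I)
    (e : closure Θ ≃ₜ closure Θ) (he : ∀ θ, (e θ : E d) ∈ Θ ↔ (θ : E d) ∈ Θ) :
    IsRegular A fun s θ => I s (e θ) where
  rateFunction θ := hI.rateFunction _
  radialMonotonicity s hs r hr := by
    have h := congrArg (e ⁻¹' ·) (hI.radialMonotonicity s hs r hr)
    simp only [e.preimage_closure] at h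
    simpa [preimage, he] using h
  continuity := by
    refine hI.continuity.comp (f := fun p : SS × closure Θ => (p.1, e p.2))
      (by fun_prop) fun p hp => ?_
    exact (he _).2 hp
  levelCompactness r :=
    ((Homeomorph.refl SS).prodCongr e).isClosedEmbedding.isCompact_preimage (hI.levelCompactness r)

theorem SatisfiesLDP.comp_homeomorph {P : Θ → Measure Ω} {S : ℕ+ → Ω → E d}
    {I : SS → closure Θ → ℝ≥0∞} (hLDP : SatisfiesLDP P S I) (e : closure Θ ≃ₜ closure Θ)
    (e₀ : Θ ≃ₜ Θ) (he : ∀ θ, toClosure (e₀ θ) = e (toClosure θ)) :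
    SatisfiesLDP (fun θ => P (e₀ θ)) S fun s θ => I s (e θ) := by
  refine ⟨fun θ => hLDP.1 _, fun θ D hD => ?_⟩
  simpa only [← he] using hLDP.2 (e₀ θ) D hD

/-- Uniform continuity and completeness of `ℝ` make the extension a true limit everywhere, not a
default value. -/
theorem continuous_predictorExt {c : X → Θ → ℝ}
    (hc : UniformContinuous fun p : X × Θ => c p.1 p.2) :
    Continuous fun p : X × closure Θ => predictorExt c p.1 p.2 := by
  have hi : IsUniformInducing (Prod.map id toClosure : X × Θ → X × closure Θ) :=
    IsUniformInducing.id.prod (isUniformEmbedding_set_inclusion subset_closure).isUniformInducing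
  exact (uniformContinuous_uniformly_extend hi (isDenseInducing_prod X Θ).dense hc).continuous

theorem predictorExt_toClosure {c : X → Θ → ℝ}
    (hc : Continuous fun p : X × Θ => c p.1 p.2) (x : X) (θ : Θ) :
    predictorExt c x (toClosure θ) = c x θ :=
  (isDenseInducing_prod X Θ).extend_eq hc (x, θ)

/-- The transformed predictor is the restriction of a continuous function on the compact space `X ×
cl Θ`, hence uniformly continuous. -/
theorem IsUniformlyContinuousBounded.comp_homeomorph [CompactSpace X] [CompactSpace (closure Θ)]
    {c : X → Θ → ℝ} (hc : IsUniformlyContinuousBounded c) (e : closure Θ ≃ₜ closure Θ)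
    (e₀ : Θ ≃ₜ Θ) (he : ∀ θ, toClosure (e₀ θ) = e (toClosure θ)) :
    IsUniformlyContinuousBounded fun x θ => c x (e₀ θ) := by
  refine ⟨?_, hc.2.imp fun C h x θ => h x _⟩
  have hcont : Continuous fun p : X × closure Θ => predictorExt c p.1 (e p.2) :=
    (continuous_predictorExt hc.1).comp (f := fun p : X × closure Θ => (p.1, e p.2)) (by fun_prop)
  have hi : UniformContinuous (Prod.map id toClosure : X × Θ → X × closure Θ) :=
    uniformContinuous_id.prodMap
      (isUniformEmbedding_set_inclusion subset_closure).isUniformInducing.uniformContinuous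
  convert (CompactSpace.uniformContinuous_of_continuous hcont).comp hi using 2 with p
  exact (he p.2 ▸ predictorExt_toClosure hc.1.continuous p.1 (e₀ p.2)).symm

theorem predictorExt_comp_homeomorph {c : X → Θ → ℝ}
    (hc : UniformContinuous fun p : X × Θ => c p.1 p.2) (e : closure Θ ≃ₜ closure Θ)
    (e₀ : Θ ≃ₜ Θ) (he : ∀ θ, toClosure (e₀ θ) = e (toClosure θ)) (x : X) (θ : closure Θ) :
    predictorExt (fun x θ => c x (e₀ θ)) x θ = predictorExt c x (e θ) := by
  have hcont : Continuous fun p : X × closure Θ => predictorExt c p.1 (e p.2) :=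
    (continuous_predictorExt hc).comp (f := fun p : X × closure Θ => (p.1, e p.2)) (by fun_prop)
  refine congrFun ((isDenseInducing_prod X Θ).extend_unique (fun p => ?_) hcont) (x, θ)
  exact he p.2 ▸ predictorExt_toClosure hc.continuous p.1 (e₀ p.2)

theorem isCompact_sublevel {A : Set SS} {I : SS → closure Θ → ℝ≥0∞} (hI : IsRegular A I)
    (s : SS) (r : ℝ≥0) : IsCompact {θ | I s θ ≤ r} :=
  by
  have hc : IsClosed {θ | I s θ ≤ r} :=
    (hI.levelCompactness r).isClosed.preimage (Continuous.prodMk_right s)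
  exact ((hI.levelCompactness r).image continuous_snd).of_isClosed_subset hc
    fun θ hθ => ⟨(s, θ), hθ, rfl⟩

/-- Both the feasible parameters and the predictor are pulled back by the same bijection, so the
values being maximized are unchanged. -/
theorem droPredictor_comp_homeomorph {c c' : X → Θ → ℝ} {I : SS → closure Θ → ℝ≥0∞}
    (e : closure Θ ≃ₜ closure Θ)
    (h : ∀ x θ, predictorExt c' x θ = predictorExt c x (e θ)) (r : ℝ≥0) (x : X) (s : SS) :
    droPredictor c' (fun s θ => I s (e θ)) r x s = droPredictor c I r x s := by
  have h1 : predictorExt c' x = predictorExt c x ∘ e := funext (h x)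
  have h2 : predictorExt c' x '' {θ | I s (e θ) ≤ r} = predictorExt c x '' {θ | I s θ ≤ r} := by
    rw [h1, image_comp]
    exact congrArg _ (image_preimage_eq {θ | I s θ ≤ r} e.surjective)
  have h3 : range (predictorExt c' x) = range (predictorExt c x) := by
    rw [h1, e.surjective.range_comp]
  have h4 : (∃ θ, I s (e θ) ≤ r) ↔ ∃ θ, I s θ ≤ r :=
    (e.surjective.exists (p := fun θ => I s θ ≤ r)).symm
  simp only [droPredictor, h2, h3]
  classical exact if_congr h4 rfl rfl

theorem isGreatest_droPredictor {c : X → Θ → ℝ}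
    (hc : UniformContinuous fun p : X × Θ => c p.1 p.2) {A : Set SS} {I : SS → closure Θ → ℝ≥0∞}
    (hI : IsRegular A I) {r : ℝ≥0} (x : X) {s : SS} (hs : ∃ θ, I s θ ≤ r) :
    IsGreatest (predictorExt c x '' {θ | I s θ ≤ r}) (droPredictor c I r x s) := by
  rw [droPredictor, if_pos hs]
  have hcont : Continuous (predictorExt c x) :=
    (continuous_predictorExt hc).comp (Continuous.prodMk_right x)
  exact ((isCompact_sublevel hI s r).image hcont).isGreatest_sSup (Nonempty.image _ hs)

/-- Compactness bounds the range, so the real `sSup` is a genuine supremum and not the default `0`.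
-/
theorem isLUB_droPredictor [CompactSpace (closure Θ)] [Nonempty (closure Θ)] {c : X → Θ → ℝ}
    (hc : UniformContinuous fun p : X × Θ => c p.1 p.2) {I : SS → closure Θ → ℝ≥0∞}
    {r : ℝ≥0} (x : X) {s : SS} (hs : ¬ ∃ θ, I s θ ≤ r) :
    IsLUB (range (predictorExt c x)) (droPredictor c I r x s) := by
  rw [droPredictor, if_neg hs]
  have hcont : Continuous (predictorExt c x) :=
    (continuous_predictorExt hc).comp (Continuous.prodMk_right x)
  exact isLUB_csSup (range_nonempty _) (isCompact_range hcont).bddAbove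

end DataDriven



/-! ### The invariance theorem -/

theorem mainTheorem7 {n m d : ℕ} {Ω : Type*} [MeasurableSpace Ω]
    (Pstar : Measure Ω)
    (X : Set (E n)) (hX : IsCompact X)
    (Θ : Set (E d)) (P : Θ → Measure Ω)
    (hP : DataDriven.IsFinitelyParametrized Pstar P)
    (c : X → Θ → ℝ) (hc : DataDriven.IsUniformlyContinuousBounded c)
    (ξ : ℕ+ → Ω → E m) (hξ : ∀ t, Measurable (ξ t))
    (S : ℕ+ → Ω → E d) (SS : Set (E d)) (Sinf : Θ → SS)
    (hS : DataDriven.IsStatistic ξ P S SS Sinf)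
    (I : SS → closure Θ → ℝ≥0∞)
    (hLDP : DataDriven.SatisfiesLDP P S I)
    (hI : DataDriven.IsRegular (range Sinf) I)
    (φ : closure Θ ≃ₜ closure Θ) :
    -- `φ` restricts to a homeomorphism `φ₀` of `Θ` onto `Θ`
    ∃ φ₀ : Θ ≃ₜ Θ, (∀ θ, DataDriven.toClosure (φ₀ θ) = φ (DataDriven.toClosure θ)) ∧
      -- the transformed ambiguity set
      DataDriven.IsFinitelyParametrized Pstar (fun θ => P (φ₀ θ)) ∧
      range (fun θ => P (φ₀ θ)) = range P ∧
      -- the transformed model-based predictor and its extension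
      DataDriven.IsUniformlyContinuousBounded (fun x θ => c x (φ₀.symm θ)) ∧
      (∀ x θ, DataDriven.predictorExt (fun x θ => c x (φ₀.symm θ)) x θ =
        DataDriven.predictorExt c x (φ.symm θ)) ∧
      -- the transformed rate function
      DataDriven.IsRegular (range Sinf) (fun s θ => I s (φ.symm θ)) ∧
      -- the family in the new coordinates, its statistic and its large deviation principle
      DataDriven.IsFinitelyParametrized Pstar (fun θ => P (φ₀.symm θ)) ∧
      range (fun θ => Sinf (φ₀.symm θ)) = range Sinf ∧
      DataDriven.IsStatistic ξ (fun θ => P (φ₀.symm θ)) S SS (fun θ => Sinf (φ₀.symm θ)) ∧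
      DataDriven.SatisfiesLDP (fun θ => P (φ₀.symm θ)) S (fun s θ => I s (φ.symm θ)) ∧
      -- invariance of the distributionally robust predictor and prescriptors
      ∀ r : ℝ≥0,
        (∀ x s, DataDriven.droPredictor (fun x θ => c x (φ₀.symm θ))
            (fun s θ => I s (φ.symm θ)) r x s = DataDriven.droPredictor c I r x s) ∧
        (∀ x s, (∃ θ, I s θ ≤ r) →
          IsGreatest (DataDriven.predictorExt c x '' {θ | I s θ ≤ r})
            (DataDriven.droPredictor c I r x s)) ∧
        (∀ x s, (¬ ∃ θ, I s θ ≤ r) →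
          IsLUB (range (DataDriven.predictorExt c x)) (DataDriven.droPredictor c I r x s)) ∧
        ∀ xt : SS → X,
          DataDriven.IsDROPrescriptor (range Sinf) (fun x θ => c x (φ₀.symm θ))
            (fun s θ => I s (φ.symm θ)) r xt ↔
          DataDriven.IsDROPrescriptor (range Sinf) c I r xt := by
  have hφ : ∀ (ψ : closure Θ ≃ₜ closure Θ) (θ : closure Θ), (θ : E d) ∈ Θ → (ψ θ : E d) ∈ Θ :=
    fun ψ _ => ψ.apply_mem_of_mem hP.convex hP.relOpen
  let φ₀ := DataDriven.restrictHomeomorph φ (hφ φ) (hφ φ.symm)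
  have hφ₀ : ∀ θ, DataDriven.toClosure (φ₀.symm θ) = φ.symm (DataDriven.toClosure θ) :=
    fun _ => rfl
  have hmem : ∀ θ, (φ.symm θ : E d) ∈ Θ ↔ (θ : E d) ∈ Θ :=
    fun θ => ⟨fun h => by simpa using hφ φ _ h, hφ φ.symm θ⟩
  have : CompactSpace X := isCompact_iff_compactSpace.1 hX
  have : CompactSpace (closure Θ) :=
    DataDriven.compactSpace_closure hP.isProbabilityMeasure hS hLDP hI
  -- `Pstar` belongs to the family, so some parameter exists.
  have : Nonempty (closure Θ) := ⟨DataDriven.toClosure hP.mem.choose⟩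
  have hext := DataDriven.predictorExt_comp_homeomorph hc.1 φ.symm φ₀.symm hφ₀
  refine ⟨φ₀, fun _ => rfl, hP.comp_homeomorph φ₀, φ₀.surjective.range_comp P,
    hc.comp_homeomorph φ.symm φ₀.symm hφ₀, hext, hI.comp_homeomorph φ.symm hmem,
    hP.comp_homeomorph φ₀.symm, φ₀.symm.surjective.range_comp Sinf,
    hS.comp_homeomorph φ₀.symm, hLDP.comp_homeomorph φ.symm φ₀.symm hφ₀, fun r => ?_⟩
  have hdro := DataDriven.droPredictor_comp_homeomorph (I := I) φ.symm hext r
  refine ⟨hdro, fun x s hs => DataDriven.isGreatest_droPredictor hc.1 hI x hs,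
    fun x s hs => DataDriven.isLUB_droPredictor hc.1 x hs, fun xt => ?_⟩
  simp only [DataDriven.IsDROPrescriptor, hdro]
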